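/- Let $\mathfrak H,\mathfrak H_*$ be complex separable Hilbert spaces, $X_0:\mathfrak H\to\mathfrak H_*$ a densely defined closed operator and $X_1:\mathfrak H\to\mathfrak H_*$ a bounded operator. For $t\in\mathbb R$ put $X(t)=X_0+tX_1$ on $\operatorname{Dom}X_0$ and $A(t)=X(t)^*X(t)$, a nonnegative selfadjoint operator in $\mathfrak H$; let $A_0=A(0)$, $\mathfrak N=\operatorname{Ker}A_0=\operatorname{Ker}X_0$, $\mathfrak N_*=\operatorname{Ker}X_0^*$, and let $P$, $P_*$ be the orthogonal projections onto $\mathfrak N$, $\mathfrak N_*$. Assume that $0$ is an isolated point of the spectrum of $A_0$, that $0<n:=\dim\mathfrak N<\infty$, and that $n\le\dim\mathfrak N_*\le\infty$. Let $d^0$ be the distance from $0$ to the rest of the spectrum of $A_0$, and fix $\delta>0$ with $8\delta<d^0$ and $t^0>0$ with $t^0\|X_1\|\le\delta^{1/2}$. Assume that for some $c_*>0$ $$A(t)\ge c_*t^2I,\qquad |t|\le t^0 .$$ Let $S=R^*R:\mathfrak N\to\mathfrak N$, where $R=P_*X_1|_{\mathfrak N}:\mathfrak N\to\mathfrak N_*$,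 be the spectral germ of the family $A(t)$ at $t=0$. Let $\lambda_l(t)$ and $\varphi_l(t)$, $l=1,\dots,n$, $|t|\le t^0$, be real-analytic branches of eigenvalues and eigenvectors of $A(t)$, that is, $A(t)\varphi_l(t)=\lambda_l(t)\varphi_l(t)$ and $\varphi_1(t),\dots,\varphi_n(t)$ form an orthonormal basis in the range of the spectral projection of $A(t)$ for the interval $[0,\delta]$. Write $\lambda_l(t)=\gamma_lt^2+\mu_lt^3+\dots$ for small $|t|$, put $\omega_l=\varphi_l(0)$, and let $N_0=\sum_{l=1}^n\mu_l(\cdot,\omega_l)\omega_l$. Suppose that $N_0\ne0$ (i.e. $\mu_l\ne0$ for some $l$). Let $\tau\in\mathbb R$, $\tau\neq0$, and $0\le s<2$. Then there does not exist a constant $C(\tau)>0$ such that the estimate $$\bigl\|\cos(\varepsilon^{-1}\tau A(t)^{1/2})P-\cos(\varepsilon^{-1}\tau(t^2S)^{1/2}P)P\bigr\|_{\mathfrak H\to\mathfrak H}\;\varepsilon^{s}(t^2+\varepsilon^2)^{-s/2}\le C(\tau)\,\varepsilon$$ holds for all sufficiently small $|t|$ and $\varepsilon>0$. -/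

import Mathlib

noncomputable section

namespace QuadPencil

open scoped InnerProductSpace LinearPMap

variable {H K : Type*} [NormedAddCommGroup H] [InnerProductSpace ℂ H] [CompleteSpace H]
  [NormedAddCommGroup K] [InnerProductSpace ℂ K] [CompleteSpace K]

/-! ### Unbounded operators -/

/-- The kernel of a partially defined operator. -/
def pker (X : H →ₗ.[ℂ] K) : Submodule ℂ H :=
  (LinearMap.ker X.toFun).map X.domain.subtype

/-- The operator `X* X` with its natural domain `{u ∈ Dom X | X u ∈ Dom X*}`. -/
def gram (X : H →ₗ.[ℂ] K) : H →ₗ.[ℂ] H where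
  domain := (X†.domain.comap X.toFun).map X.domain.subtype
  toFun :=
    { toFun := fun u =>
        X† ⟨X ⟨u, by obtain ⟨v, -, hv⟩ := u.2; rw [← hv]; exact v.2⟩, by
          obtain ⟨u, v, hv, rfl⟩ := u; exact hv⟩
      map_add' := fun u v => by
        rw [← LinearPMap.map_add]; congr 1; ext; simp only [Submodule.coe_add]
        rw [← LinearPMap.map_add]; rfl
      map_smul' := fun c u => by
        rw [RingHom.id_apply, ← LinearPMap.map_smul]; congr 1; ext
        simp only [Submodule.coe_smul]
        rw [← LinearPMap.map_smul]; rfl }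

/-- `T` is the bounded inverse of `A - z`. -/
def IsResolventAt (A : H →ₗ.[ℂ] H) (z : ℂ) (T : H →L[ℂ] H) : Prop :=
  (∀ u : H, ∃ h : T u ∈ A.domain, A ⟨T u, h⟩ - z • T u = u) ∧
    ∀ v : A.domain, T (A v - z • (v : H)) = v

/-- The spectrum of a partially defined operator: the set of all `z` for which `A - z` has no
bounded everywhere defined inverse. -/
def pspectrum (A : H →ₗ.[ℂ] H) : Set ℂ :=
  {z | ¬ ∃ T : H →L[ℂ] H, IsResolventAt A z T}

open Classical in
/-- The resolvent `(A - z)⁻¹` (and `0` if `z` lies in the spectrum). -/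
def resolventAt (A : H →ₗ.[ℂ] H) (z : ℂ) : H →L[ℂ] H :=
  if h : ∃ T : H →L[ℂ] H, IsResolventAt A z T then h.choose else 0

open Classical in
/-- The bounded operator `f(A)` of the functional calculus, for a nonnegative selfadjoint
(possibly unbounded) operator `A` and a bounded continuous function `f` on `[0, ∞)`.
Put `T = (A + 1)⁻¹`, so that `0 ≤ T ≤ 1` and `A = T⁻¹ - 1`. Then `f(A)` is the unique bounded
operator with `f(A) T = g(T)`, `g(x) = x f(x⁻¹ - 1)`, where `g(T)` is given by the continuous
functional calculus of the bounded selfadjoint operator `T`. For `A = X* X`, existence and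
uniqueness are proved in `existsUnique_funcCalc`. -/
def funcCalc (A : H →ₗ.[ℂ] H) (f : ℝ → ℝ) : H →L[ℂ] H :=
  if h : ∃ B : H →L[ℂ] H,
      B ∘L resolventAt A (-1) = cfc (fun x : ℝ => x * f (x⁻¹ - 1)) (resolventAt A (-1))
  then h.choose else 0

/-- The range of the spectral projection of the nonnegative selfadjoint operator `A` for the
closed set `Q`: the vectors whose spectral measure with respect to `A` is carried by `Q`, i.e.
those annihilated by `f(A)` for all bounded continuous `f` vanishing on `Q`. -/
def spectralSubspace (A : H →ₗ.[ℂ] H) (Q : Set ℝ) : Submodule ℂ H :=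
  ⨅ f : {f : BoundedContinuousFunction ℝ ℝ // ∀ x ∈ Q, f x = 0},
    LinearMap.ker (funcCalc A (fun x => f.1 x)).toLinearMap

/-- The orthogonal projection onto (the closure of) a subspace. It is only used for kernels of
closed operators, which are closed. -/
def orthProj (N : Submodule ℂ H) : H →L[ℂ] H :=
  N.topologicalClosure.starProjection

/-! ### The operator pencil -/

/-- `X(t) = X₀ + t X₁` with domain `Dom X₀`. -/
def pencil (X₀ : H →ₗ.[ℂ] K) (X₁ : H →L[ℂ] K) (t : ℝ) : H →ₗ.[ℂ] K :=
  ((t : ℂ) • X₁).toLinearMap +ᵥ X₀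

/-- `A(t) = X(t)* X(t)`. -/
def opA (X₀ : H →ₗ.[ℂ] K) (X₁ : H →L[ℂ] K) (t : ℝ) : H →ₗ.[ℂ] H :=
  gram (pencil X₀ X₁ t)

/-- The operator `R P : H → K`, `R = P_* X₁|_𝔑`, where `P`, `P_*` are the orthogonal projections
onto `𝔑 = Ker X₀` and `𝔑_* = Ker X₀*`. -/
def opRP (X₀ : H →ₗ.[ℂ] K) (X₁ : H →L[ℂ] K) : H →L[ℂ] K :=
  orthProj (pker X₀†) ∘L X₁ ∘L orthProj (pker X₀)

/-- The spectral germ `S = R* R : 𝔑 → 𝔑`, extended by zero to `𝔑ᗮ`, i.e. the operator `S P`. -/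
def germ (X₀ : H →ₗ.[ℂ] K) (X₁ : H →L[ℂ] K) : H →L[ℂ] H :=
  (opRP X₀ X₁).adjoint ∘L opRP X₀ X₁

/-- `lam`, `φ` are the analytic branches of eigenvalues and eigenvectors of `A(t)`, `|t| ≤ t⁰`:
they are real-analytic, `A(t) φ_l(t) = λ_l(t) φ_l(t)`, and the `φ_l(t)` form an orthonormal basis
in the spectral subspace of `A(t)` for the interval `[0, δ]`. -/
structure IsBranchSystem (X₀ : H →ₗ.[ℂ] K) (X₁ : H →L[ℂ] K) (δ t₀ : ℝ) {n : ℕ}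
    (lam : Fin n → ℝ → ℝ) (φ : Fin n → ℝ → H) : Prop where
  analytic_lam : ∀ l, AnalyticOn ℝ (lam l) (Set.Icc (-t₀) t₀)
  analytic_vec : ∀ l, AnalyticOn ℝ (φ l) (Set.Icc (-t₀) t₀)
  eigen : ∀ l, ∀ t ∈ Set.Icc (-t₀) t₀, ∃ h : φ l t ∈ (opA X₀ X₁ t).domain,
    opA X₀ X₁ t ⟨φ l t, h⟩ = (lam l t : ℂ) • φ l t
  orthonormal : ∀ t ∈ Set.Icc (-t₀) t₀, Orthonormal ℂ (fun l => φ l t)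
  span : ∀ t ∈ Set.Icc (-t₀) t₀,
    Submodule.span ℂ (Set.range fun l => φ l t) =
      spectralSubspace (opA X₀ X₁ t) (Set.Icc 0 δ)

/-- The Taylor coefficient `μ_l` in `λ_l(t) = γ_l t² + μ_l t³ + …`. -/
def mu {n : ℕ} (lam : Fin n → ℝ → ℝ) (l : Fin n) : ℝ :=
  iteratedDeriv 3 (lam l) 0 / 6

/-- `N₀ = ∑ μ_l (·, ω_l) ω_l` with `ω_l = φ_l(0)`. -/
def opN₀ {n : ℕ} (lam : Fin n → ℝ → ℝ) (φ : Fin n → ℝ → H) : H →L[ℂ] H :=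
  ∑ l, (mu lam l : ℂ) • InnerProductSpace.rankOne ℂ (φ l 0) (φ l 0)

/-- `cos(r A^{1/2})` for a nonnegative selfadjoint operator `A`. -/
def cosSqrt (r : ℝ) (A : H →ₗ.[ℂ] H) : H →L[ℂ] H :=
  funcCalc A (fun x => Real.cos (r * √x))

/-- `cos(r B^{1/2})` for a bounded nonnegative selfadjoint operator `B`. -/
def cosSqrtBdd (r : ℝ) (B : H →L[ℂ] H) : H →L[ℂ] H :=
  cfc (fun x : ℝ => Real.cos (r * √x)) B


/-! ### Well-definedness -/

theorem gram_inner {X : H →ₗ.[ℂ] K} (hX : Dense (X.domain : Set H)) (u : (gram X).domain) :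
    ∃ h : (u : H) ∈ X.domain, ∀ w : X.domain, ⟪gram X u, (w : H)⟫_ℂ = ⟪X ⟨u, h⟩, X w⟫_ℂ := by
  obtain ⟨u, v, hv, rfl⟩ := u
  exact ⟨v.2, fun w => LinearPMap.adjoint_isFormalAdjoint hX ⟨X v, hv⟩ w⟩

theorem gram_of_inner {X : H →ₗ.[ℂ] K} (hX : Dense (X.domain : Set H)) (v : X.domain) (y : H)
    (hy : ∀ w : X.domain, ⟪y, (w : H)⟫_ℂ = ⟪X v, X w⟫_ℂ) :
    ∃ h : (v : H) ∈ (gram X).domain, gram X ⟨v, h⟩ = y := by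
  have h1 : X v ∈ X†.domain := LinearPMap.mem_adjoint_domain_of_exists _ ⟨y, hy⟩
  exact ⟨⟨v, h1, rfl⟩, LinearPMap.adjoint_apply_eq hX ⟨X v, h1⟩ hy⟩

/-- `(X* X + 1)⁻¹` exists, lies between `0` and `1`, and has dense range. -/
theorem exists_resolvent_gram {X : H →ₗ.[ℂ] K} (hX : Dense (X.domain : Set H))
    (hc : X.IsClosed) :
    ∃ T : H →L[ℂ] H, IsResolventAt (gram X) (-1) T ∧ 0 ≤ T ∧ ‖T‖ ≤ 1 ∧ DenseRange T := by
  let G : Submodule ℂ (WithLp 2 (H × K)) :=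
    X.graph.comap (WithLp.linearEquiv 2 ℂ (H × K)).toLinearMap
  have hG : IsClosed (G : Set (WithLp 2 (H × K))) :=
    IsClosed.preimage (WithLp.prod_continuous_ofLp 2 H K) hc
  have : CompleteSpace G := hG.completeSpace_coe
  let J : G →L[ℂ] H := (WithLp.fstL 2 ℂ H K) ∘L G.subtypeL
  have hJ : ∀ g : G, J g = (g : WithLp 2 (H × K)).fst := fun g => rfl
  have hel : ∀ g : G, ∃ h : (g : WithLp 2 (H × K)).fst ∈ X.domain,
      X ⟨_, h⟩ = (g : WithLp 2 (H × K)).snd := by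
    intro g
    have := g.2
    simp only [G, Submodule.mem_comap, LinearPMap.mem_graph_iff] at this
    obtain ⟨y, h1, h2⟩ := this
    have h1' : (y : H) = (g : WithLp 2 (H × K)).fst := h1
    refine ⟨h1' ▸ y.2, ?_⟩
    rw [show (⟨(g : WithLp 2 (H × K)).fst, h1' ▸ y.2⟩ : X.domain) = y from Subtype.ext h1'.symm]
    exact h2
  have mk : ∀ w : X.domain, ∃ g : G, (g : WithLp 2 (H × K)).fst = w ∧
      (g : WithLp 2 (H × K)).snd = X w := fun w =>
    ⟨⟨WithLp.toLp 2 ((w : H), X w), by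
      simp only [G, Submodule.mem_comap]; exact LinearPMap.mem_graph X w⟩, rfl, rfl⟩
  have hin : ∀ (u : H) (g : G), ⟪(J.adjoint u : WithLp 2 (H × K)).fst,
      (g : WithLp 2 (H × K)).fst⟫_ℂ + ⟪(J.adjoint u : WithLp 2 (H × K)).snd,
      (g : WithLp 2 (H × K)).snd⟫_ℂ = ⟪u, (g : WithLp 2 (H × K)).fst⟫_ℂ := by
    intro u g
    exact (WithLp.prod_inner_apply (𝕜 := ℂ) (J.adjoint u : WithLp 2 (H × K))
      (g : WithLp 2 (H × K))).symm.trans (ContinuousLinearMap.adjoint_inner_left J g u)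
  refine ⟨J ∘L J.adjoint, ⟨?_, ?_⟩, ?_, ?_, ?_⟩
  · intro u
    obtain ⟨h, hX'⟩ := hel (J.adjoint u)
    obtain ⟨h2, h3⟩ := gram_of_inner hX ⟨_, h⟩ (u - (J.adjoint u : WithLp 2 (H × K)).fst) (by
      intro w
      obtain ⟨g, hg1, hg2⟩ := mk w
      have := hin u g
      rw [hg1, hg2] at this
      rw [inner_sub_left, ← this, hX']
      ring)
    refine ⟨h2, ?_⟩
    change gram X ⟨(J.adjoint u : WithLp 2 (H × K)).fst, h2⟩ -
      (-1 : ℂ) • (J.adjoint u : WithLp 2 (H × K)).fst = u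
    rw [h3]; simp
  · intro v
    obtain ⟨h, hv⟩ := gram_inner hX v
    obtain ⟨g, hg1, hg2⟩ := mk ⟨v, h⟩
    have : J.adjoint (gram X v - (-1 : ℂ) • (v : H)) = g := by
      refine ext_inner_right ℂ fun g' => ?_
      rw [ContinuousLinearMap.adjoint_inner_left]
      obtain ⟨h', hX'⟩ := hel g'
      have e : ⟪g, g'⟫_ℂ = ⟪(g : WithLp 2 (H × K)).fst, (g' : WithLp 2 (H × K)).fst⟫_ℂ +
        ⟪(g : WithLp 2 (H × K)).snd, (g' : WithLp 2 (H × K)).snd⟫_ℂ :=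
        WithLp.prod_inner_apply _ _
      rw [e, hJ, hg1, hg2, inner_sub_left, hv ⟨_, h'⟩, hX']
      simp [add_comm]
    rw [ContinuousLinearMap.comp_apply, this, hJ, hg1]
  · rw [ContinuousLinearMap.nonneg_iff_isPositive]
    simpa using ContinuousLinearMap.isPositive_self_comp_adjoint J
  · have hJn : ‖J‖ ≤ 1 := by
      refine J.opNorm_le_bound zero_le_one fun g => ?_
      rw [hJ, one_mul]
      exact WithLp.norm_fst_le (p := 2) _ (g : WithLp 2 (H × K))
    calc ‖J ∘L J.adjoint‖ ≤ ‖J‖ * ‖J.adjoint‖ := ContinuousLinearMap.opNorm_comp_le _ _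
      _ ≤ 1 * 1 := by
        rw [LinearIsometryEquiv.norm_map]; gcongr
      _ = 1 := one_mul 1
  · have : (LinearMap.range (J ∘L J.adjoint).toLinearMap).topologicalClosure = ⊤ := by
      rw [Submodule.topologicalClosure_eq_top_iff, eq_bot_iff]
      intro u hu
      rw [Submodule.mem_orthogonal] at hu
      have h0 := hu _ ⟨u, rfl⟩
      have h1 : J.adjoint u = 0 := by
        have : ⟪J.adjoint u, J.adjoint u⟫_ℂ = 0 := by
          rw [ContinuousLinearMap.adjoint_inner_right]; exact h0
        exact inner_self_eq_zero.1 this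
      refine hX.eq_zero_of_inner_left ℂ fun w hw => ?_
      obtain ⟨g, hg1, -⟩ := mk ⟨w, hw⟩
      have := hin u g
      rw [h1, hg1] at this
      simpa using this.symm
    have h2 := congrArg (fun N : Submodule ℂ H => (N : Set H)) this
    simp only [Submodule.topologicalClosure_coe, Submodule.top_coe] at h2
    exact dense_iff_closure_eq.2 h2

theorem resolventAt_spec {A : H →ₗ.[ℂ] H} {z : ℂ} {T : H →L[ℂ] H} (h : IsResolventAt A z T) :
    resolventAt A z = T := by
  have hex : ∃ T : H →L[ℂ] H, IsResolventAt A z T := ⟨T, h⟩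
  have h' : IsResolventAt A z (resolventAt A z) := by
    rw [resolventAt, dif_pos hex]; exact hex.choose_spec
  ext u
  obtain ⟨hm, hu⟩ := h.1 u
  have := h'.2 ⟨T u, hm⟩
  rw [hu] at this
  exact this

/-- For `A = X* X` and `f` continuous and bounded on `[0, ∞)`, the operator `f(A)` of `funcCalc`
exists, is unique, and is bounded by `sup |f|`. -/
theorem existsUnique_funcCalc {X : H →ₗ.[ℂ] K} (hX : Dense (X.domain : Set H))
    (hc : X.IsClosed) {f : ℝ → ℝ} (hf : ContinuousOn f (Set.Ici 0)) {M : ℝ}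
    (hM : ∀ x, 0 ≤ x → |f x| ≤ M) :
    (∃! B : H →L[ℂ] H, B ∘L resolventAt (gram X) (-1) =
      cfc (fun x : ℝ => x * f (x⁻¹ - 1)) (resolventAt (gram X) (-1))) ∧
    funcCalc (gram X) f ∘L resolventAt (gram X) (-1) =
      cfc (fun x : ℝ => x * f (x⁻¹ - 1)) (resolventAt (gram X) (-1)) ∧
    ‖funcCalc (gram X) f‖ ≤ M := by
  obtain ⟨T, hT, hT0, hT1, hTd⟩ := exists_resolvent_gram hX hc
  have hM0 : 0 ≤ M := (abs_nonneg _).trans (hM 0 le_rfl)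
  have hR := resolventAt_spec hT
  have hsa : IsSelfAdjoint T := IsSelfAdjoint.of_nonneg hT0
  have hsp : spectrum ℝ T ⊆ Set.Icc 0 1 := by
    intro x hx
    refine ⟨spectrum_nonneg_of_nonneg hT0 hx, (le_abs_self x).trans ?_⟩
    have := spectrum.norm_le_norm_mul_of_mem hx
    calc |x| ≤ ‖T‖ * ‖(1 : H →L[ℂ] H)‖ := this
      _ ≤ 1 * 1 := by gcongr; exact ContinuousLinearMap.norm_id_le
      _ = 1 := one_mul 1
  set g : ℝ → ℝ := fun x => x * f (x⁻¹ - 1) with hg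
  have hgb : ∀ x ∈ Set.Icc (0 : ℝ) 1, |g x| ≤ M * |x| := by
    rintro x ⟨h0, h1⟩
    rcases h0.eq_or_lt with rfl | h0
    · simp [hg]
    · rw [hg]; simp only; rw [abs_mul, mul_comm]
      gcongr
      exact hM _ (sub_nonneg.2 (one_le_inv₀ h0 |>.2 h1))
  have hgc : ContinuousOn g (Set.Icc 0 1) := by
    rintro x ⟨h0, h1⟩
    rcases h0.eq_or_lt with rfl | h0
    · have hg0 : g 0 = 0 := by simp [hg]
      rw [ContinuousWithinAt, hg0]
      refine squeeze_zero_norm' (a := fun x => M * |x|) ?_ ?_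
      · filter_upwards [self_mem_nhdsWithin] with y hy using hgb y hy
      · have : Filter.Tendsto (fun x : ℝ => M * |x|) (nhds 0) (nhds (M * |0|)) :=
          (continuous_const.mul continuous_abs).tendsto 0
        simp only [abs_zero, mul_zero] at this
        exact this.mono_left nhdsWithin_le_nhds
    · refine continuousWithinAt_id.mul ?_
      have h2 : ContinuousWithinAt (fun x : ℝ => x⁻¹ - 1) (Set.Icc 0 1 ∩ Set.Ioi 0) x :=
        ((continuousAt_inv₀ h0.ne').sub continuousAt_const).continuousWithinAt
      have h3 : ContinuousWithinAt (fun x => f (x⁻¹ - 1)) (Set.Icc 0 1 ∩ Set.Ioi 0) x := by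
        refine ContinuousWithinAt.comp (t := Set.Ici 0)
          (hf _ (sub_nonneg.2 (one_le_inv₀ h0 |>.2 h1))) h2 ?_
        rintro y ⟨⟨-, hy1⟩, hy0⟩
        exact sub_nonneg.2 (one_le_inv₀ hy0 |>.2 hy1)
      exact h3.mono_of_mem_nhdsWithin
        (Filter.inter_mem self_mem_nhdsWithin (nhdsWithin_le_nhds (Ioi_mem_nhds h0)))
  have hgc' := hgc.mono hsp
  have hgsa : IsSelfAdjoint (cfc g T) := cfc_predicate g T
  have hsq : cfc g T * cfc g T ≤ (M ^ 2) • (T * T) := by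
    rw [← cfc_mul g g T hgc' hgc']
    have e : (M ^ 2) • (T * T) = cfc (fun x : ℝ => M ^ 2 * (x * x)) T := by
      rw [cfc_const_mul (M ^ 2) (fun x : ℝ => x * x) T (by fun_prop),
        cfc_mul (fun x : ℝ => x) (fun x : ℝ => x) T (by fun_prop) (by fun_prop), cfc_id' ℝ T]
    rw [e]
    refine cfc_mono (fun x hx => ?_) (hgc'.mul hgc') (by fun_prop)
    have := hgb x (hsp hx)
    have h2 := mul_self_le_mul_self (abs_nonneg _) this
    rw [abs_mul_abs_self] at h2
    nlinarith [abs_mul_abs_self x]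
  have hnorm : ∀ u, ‖cfc g T u‖ ≤ M * ‖T u‖ := by
    intro u
    have h1 := ((ContinuousLinearMap.le_def _ _).1 hsq).re_inner_nonneg_left u
    have ha : ⟪cfc g T (cfc g T u), u⟫_ℂ = ⟪cfc g T u, cfc g T u⟫_ℂ :=
      hgsa.isSymmetric _ _
    have hb : ⟪T (T u), u⟫_ℂ = ⟪T u, T u⟫_ℂ := hsa.isSymmetric _ _
    have h3 : ((M ^ 2) • (T * T) - cfc g T * cfc g T) u =
      (M ^ 2) • T (T u) - cfc g T (cfc g T u) := rfl
    rw [h3, inner_sub_left, inner_smul_left_eq_smul, ha, hb, map_sub, RCLike.smul_re] at h1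
    rw [inner_self_eq_norm_sq, inner_self_eq_norm_sq] at h1
    refine le_of_sq_le_sq ?_ (by positivity)
    nlinarith
  have huniq : ∀ B B' : H →L[ℂ] H, B ∘L T = cfc g T → B' ∘L T = cfc g T → B = B' := by
    intro B B' h h'
    have := hTd.equalizer B.continuous B'.continuous (funext fun u => by
      exact congrArg (fun S : H →L[ℂ] H => S u) (h.trans h'.symm))
    exact DFunLike.coe_injective this
  set B := LinearMap.extendOfNorm (cfc g T).toLinearMap T.toLinearMap with hBdef
  have hB : B ∘L T = cfc g T := by
    ext u
    exact LinearMap.extendOfNorm_eq (f := (cfc g T).toLinearMap) (e := T.toLinearMap)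
      hTd ⟨M, hnorm⟩ u
  have hBn : ‖B‖ ≤ M := LinearMap.opNorm_extendOfNorm_le (f := (cfc g T).toLinearMap)
    (e := T.toLinearMap) hTd hM0 hnorm
  rw [hR]
  have hex : ∃ B : H →L[ℂ] H, B ∘L resolventAt (gram X) (-1) =
    cfc (fun x : ℝ => x * f (x⁻¹ - 1)) (resolventAt (gram X) (-1)) := by
    rw [hR]; exact ⟨B, hB⟩
  have hF : funcCalc (gram X) f ∘L T = cfc g T := by
    have := hex.choose_spec
    have h2 : funcCalc (gram X) f = hex.choose := by rw [funcCalc, dif_pos hex]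
    rw [← h2, hR] at this
    exact this
  exact ⟨⟨B, hB, fun B' h' => huniq _ _ h' hB⟩, hF, by rw [huniq _ _ hF hB]; exact hBn⟩

/-- If `ϕ ∈ Dom X₀` is a weak solution of `X₀*(X₀ ϕ + X₁ ω) = 0`, then
`X₀ ϕ + X₁ ω = P_* X₁ ω`. -/
theorem corrector_eq {X₀ : H →ₗ.[ℂ] K} (hX : Dense (X₀.domain : Set H)) (X₁ : H →L[ℂ] K)
    (ω : H) (ϕ : X₀.domain)
    (h : ∀ ζ : X₀.domain, ⟪X₀ ϕ, X₀ ζ⟫_ℂ = -⟪X₁ ω, X₀ ζ⟫_ℂ) :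
    X₀ ϕ + X₁ ω = orthProj (pker X₀†) (X₁ ω) := by
  have hmem : ∀ ζ : X₀.domain, ⟪X₀ ϕ + X₁ ω, X₀ ζ⟫_ℂ = 0 := fun ζ => by
    rw [inner_add_left, h]; simp
  have hd : X₀ ϕ + X₁ ω ∈ X₀†.domain :=
    LinearPMap.mem_adjoint_domain_of_exists _ ⟨0, fun ζ => by rw [hmem]; simp⟩
  have hk : X₀ ϕ + X₁ ω ∈ pker X₀† :=
    ⟨⟨_, hd⟩, LinearMap.mem_ker.2 (LinearPMap.adjoint_apply_eq hX ⟨_, hd⟩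
      fun ζ => by rw [hmem]; simp), rfl⟩
  refine (Submodule.eq_starProjection_of_mem_of_inner_eq_zero
    (Submodule.le_topologicalClosure _ hk) ?_).symm
  have : X₁ ω - (X₀ ϕ + X₁ ω) = -(X₀ ϕ) := by abel
  intro w hw
  rw [this, inner_neg_left, neg_eq_zero]
  have hcl : IsClosed {w : K | ⟪X₀ ϕ, w⟫_ℂ = 0} :=
    isClosed_eq (by fun_prop) continuous_const
  refine closure_minimal ?_ hcl (a := w) hw
  rintro _ ⟨w, hw, rfl⟩
  have h1 := LinearPMap.adjoint_isFormalAdjoint hX w ϕ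
  have h2 : X₀† w = 0 := hw
  rw [h2, inner_zero_left] at h1
  exact inner_eq_zero_symm.1 h1.symm

end QuadPencil

end

noncomputable section

namespace QuadPencil

open scoped InnerProductSpace LinearPMap Topology
open Filter

set_option linter.unusedSectionVars false

variable {H K : Type*} [NormedAddCommGroup H] [InnerProductSpace ℂ H] [CompleteSpace H]
  [NormedAddCommGroup K] [InnerProductSpace ℂ K] [CompleteSpace K]

/-! ### The functional calculus on eigenvectors -/

/-! The two cosines differ by a phase that stays bounded away from zero at the scale `ε ~ t²`. Fix
`l` with `μ_l ≠ 0` and write `λ`, `φ`, `γ`, `μ` for its data. Since `√λ(t) = t√γ + μt²/(2√γ) +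
o(t²)` as `t → 0+`, putting `ε = θt²` makes `ε⁻¹τ√λ(t)` and `ε⁻¹τt√γ` differ by a phase with limit
`τμ/(2θ√γ)`. The number `θ` is chosen so that this limit is `±π`, and `t` runs through a sequence
along which the unperturbed phase is a multiple of `2π`. One cosine is then `1` and the other tends
to `-1`.

To pass to operators, test the difference on the single unit vector `ω = φ(0)`. It lies in `𝔑` and
satisfies `Sω = γω` (`germ_apply_of_tendsto`), so the germ cosine acts on it as a scalar. The cosine
of `A(t)` acts as a scalar on `φ(t)`, and replacing `ω` by `φ(t)` costs at most `2‖φ(t) - ω‖ → 0`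
(`abs_cos_sub_cos_le`). Along `ε = θt²` the supposed estimate bounds the operator norm by a multiple
of `t^(2-s)(1+θ²t²)^(s/2)`, which vanishes in the limit because `s < 2`. Altogether `2 ≤ 0`. -/

theorem cfc_apply_of_eigenvector {T : H →L[ℂ] H} (hT : IsSelfAdjoint T) {x : ℝ} {v : H}
    (hv : T v = (x : ℂ) • v) {g : ℝ → ℝ} (hg : ContinuousOn g (spectrum ℝ T)) :
    cfc g T v = (g x : ℂ) • v := by
  rcases eq_or_ne v 0 with rfl | hv0
  · simp
  have hx : x ∈ spectrum ℝ T := by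
    rw [spectrum.mem_iff]
    intro hu
    obtain ⟨S, hS⟩ := hu.exists_left_inv
    have h1 : (algebraMap ℝ (H →L[ℂ] H) x - T) v = 0 := by
      rw [sub_apply, hv, Algebra.algebraMap_eq_smul_one]
      simp
    apply hv0
    have h2 := congrArg (fun B : H →L[ℂ] H => B v) hS
    simp only [mul_apply_eq_comp, h1, map_zero, one_apply_eq_self] at h2
    exact h2.symm
  -- Stone–Weierstrass induction: constants and the identity generate a dense star algebra in
  -- `C(spectrum ℝ T, ℝ)`, and the property is closed under uniform limits.
  have key : ∀ f : C(spectrum ℝ T, ℝ), cfcHom hT f v = ((f ⟨x, hx⟩ : ℝ) : ℂ) • v := by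
    intro f
    induction f using ContinuousMap.induction_on_of_compact with
    | const r =>
      have : cfcHom hT (ContinuousMap.const (spectrum ℝ T) r) = algebraMap ℝ (H →L[ℂ] H) r :=
        AlgHomClass.commutes (cfcHom hT) r
      rw [this, Algebra.algebraMap_eq_smul_one]
      simp
    | id => rw [cfcHom_id hT, hv]; rfl
    | star_id => rw [map_star, cfcHom_id hT, hT.star_eq, hv]; rfl
    | add f g hf hg =>
      rw [map_add, add_apply, hf, hg, ← add_smul]; simp
    | mul f g hf hg =>
      rw [map_mul, mul_apply_eq_comp, hg, map_smul, hf, smul_smul]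
      simp [mul_comm]
    | frequently f h =>
      refine h.mem_of_closed (isClosed_eq ?_ ?_)
      · exact ((ContinuousLinearMap.apply ℂ H v).continuous).comp (cfcHom_continuous hT)
      · exact (Complex.continuous_ofReal.comp (continuous_eval_const _)).smul
          continuous_const
  rw [cfc_apply g T hT hg]
  exact key _

/-- Only `x = 0` is delicate: `f(x⁻¹ - 1)` may oscillate there, but it is bounded and the factor `x`
damps it. -/
theorem continuousOn_mul_comp_inv_sub_one {f : ℝ → ℝ} (hf : ContinuousOn f (Set.Ici 0)) {M : ℝ}
    (hM : ∀ x, 0 ≤ x → |f x| ≤ M) :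
    ContinuousOn (fun x : ℝ => x * f (x⁻¹ - 1)) (Set.Icc 0 1) := by
  have hge : ∀ x : ℝ, 0 < x → x ≤ 1 → 0 ≤ x⁻¹ - 1 := fun x h0 h1 =>
    sub_nonneg.2 (one_le_inv₀ h0 |>.2 h1)
  rintro x ⟨h0, h1⟩
  rcases h0.eq_or_lt with rfl | h0
  · rw [ContinuousWithinAt, zero_mul]
    refine squeeze_zero_norm' (a := fun x => |x| * M) ?_ ?_
    · filter_upwards [self_mem_nhdsWithin] with y hy
      rcases hy.1.eq_or_lt with rfl | hy0
      · simp
      · rw [Real.norm_eq_abs, abs_mul]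
        gcongr
        exact hM _ (hge y hy0 hy.2)
    · have : Tendsto (fun x : ℝ => |x| * M) (𝓝 0) (𝓝 (|0| * M)) :=
        (continuous_abs.mul continuous_const).tendsto 0
      simp only [abs_zero, zero_mul] at this
      exact this.mono_left nhdsWithin_le_nhds
  · refine continuousWithinAt_id.mul ?_
    have h2 : ContinuousWithinAt (fun x : ℝ => x⁻¹ - 1) (Set.Icc 0 1 ∩ Set.Ioi 0) x :=
      ((continuousAt_inv₀ h0.ne').sub continuousAt_const).continuousWithinAt
    have h3 : ContinuousWithinAt (fun x => f (x⁻¹ - 1)) (Set.Icc 0 1 ∩ Set.Ioi 0) x :=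
      ContinuousWithinAt.comp (t := Set.Ici 0) (hf _ (hge x h0 h1)) h2
        fun y hy => hge y hy.2 hy.1.2
    exact h3.mono_of_mem_nhdsWithin
      (inter_mem self_mem_nhdsWithin (nhdsWithin_le_nhds (Ioi_mem_nhds h0)))

/-- The resolvent `T` has eigenvalue `(1+x)⁻¹` on `v`, where `g` takes the value `(1+x)⁻¹ f(x)`;
cancelling `(1+x)⁻¹` in `f(A) T v = g(T) v` leaves `f(x)`. -/
theorem funcCalc_apply_of_eigenvector {X : H →ₗ.[ℂ] K} (hX : Dense (X.domain : Set H))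
    (hc : X.IsClosed) {f : ℝ → ℝ} (hf : ContinuousOn f (Set.Ici 0)) {M : ℝ}
    (hM : ∀ x, 0 ≤ x → |f x| ≤ M) {x : ℝ} (hx : 0 ≤ x) {v : H} (hv : v ∈ (gram X).domain)
    (hev : gram X ⟨v, hv⟩ = (x : ℂ) • v) :
    funcCalc (gram X) f v = (f x : ℂ) • v := by
  obtain ⟨T, hT, hT0, hT1, -⟩ := exists_resolvent_gram hX hc
  have hsp : spectrum ℝ T ⊆ Set.Icc 0 1 := by
    intro y hy
    refine ⟨spectrum_nonneg_of_nonneg hT0 hy, (le_abs_self y).trans ?_⟩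
    calc |y| ≤ ‖T‖ * ‖(1 : H →L[ℂ] H)‖ := spectrum.norm_le_norm_mul_of_mem hy
      _ ≤ 1 * 1 := by gcongr; exact ContinuousLinearMap.norm_id_le
      _ = 1 := one_mul 1
  have hx1 : (0 : ℝ) < 1 + x := by positivity
  have hx1' : ((1 + x : ℝ) : ℂ) ≠ 0 := Complex.ofReal_ne_zero.2 hx1.ne'
  have hTv : T v = (((1 + x)⁻¹ : ℝ) : ℂ) • v := by
    have h := hT.2 ⟨v, hv⟩
    simp only [hev] at h
    have h2 : (x : ℂ) • v - (-1 : ℂ) • v = ((1 + x : ℝ) : ℂ) • v := by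
      rw [← sub_smul]; congr 1; push_cast; ring
    rw [h2, map_smul] at h
    rw [Complex.ofReal_inv, eq_inv_smul_iff₀ hx1', h]
  have hcomp := (existsUnique_funcCalc hX hc hf hM).2.1
  rw [resolventAt_spec hT] at hcomp
  have h1 := congrArg (fun B : H →L[ℂ] H => B v) hcomp
  simp only [ContinuousLinearMap.comp_apply] at h1
  rw [cfc_apply_of_eigenvector (IsSelfAdjoint.of_nonneg hT0) hTv
    ((continuousOn_mul_comp_inv_sub_one hf hM).mono hsp), hTv, map_smul, inv_inv,
    add_sub_cancel_left, Complex.ofReal_mul, mul_smul] at h1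
  exact smul_right_injective H (by simpa using hx1') h1

theorem continuous_cos_mul_sqrt (r : ℝ) : Continuous fun x : ℝ => Real.cos (r * √x) := by
  fun_prop

theorem cosSqrt_apply_of_eigenvector {X : H →ₗ.[ℂ] K} (hX : Dense (X.domain : Set H))
    (hc : X.IsClosed) (r : ℝ) {x : ℝ} (hx : 0 ≤ x) {v : H} (hv : v ∈ (gram X).domain)
    (hev : gram X ⟨v, hv⟩ = (x : ℂ) • v) :
    cosSqrt r (gram X) v = (Real.cos (r * √x) : ℂ) • v :=
  funcCalc_apply_of_eigenvector hX hc (f := fun x => Real.cos (r * √x))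
    (continuous_cos_mul_sqrt r).continuousOn (fun _ _ => Real.abs_cos_le_one _) hx hv hev

theorem norm_cosSqrt_le_one {X : H →ₗ.[ℂ] K} (hX : Dense (X.domain : Set H))
    (hc : X.IsClosed) (r : ℝ) : ‖cosSqrt r (gram X)‖ ≤ 1 :=
  (existsUnique_funcCalc hX hc (f := fun x => Real.cos (r * √x))
    (continuous_cos_mul_sqrt r).continuousOn fun _ _ => Real.abs_cos_le_one _).2.2

theorem gram_eigenvector_of_mem_pker {X : H →ₗ.[ℂ] K} (hX : Dense (X.domain : Set H)) {v : H}
    (hv : v ∈ pker X) : ∃ h : v ∈ (gram X).domain, gram X ⟨v, h⟩ = 0 := by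
  obtain ⟨w, hw, rfl⟩ := hv
  have hw' : X w = 0 := hw
  exact gram_of_inner hX w 0 fun u => by rw [hw']; simp

theorem pker_le_spectralSubspace {X : H →ₗ.[ℂ] K} (hX : Dense (X.domain : Set H))
    (hc : X.IsClosed) {Q : Set ℝ} (hQ : 0 ∈ Q) : pker X ≤ spectralSubspace (gram X) Q := by
  intro v hv
  obtain ⟨h, hv0⟩ := gram_eigenvector_of_mem_pker hX hv
  rw [spectralSubspace, Submodule.mem_iInf]
  rintro ⟨f, hf⟩
  have := funcCalc_apply_of_eigenvector hX hc f.continuous.continuousOn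
    (fun x _ => f.norm_coe_le_norm x) le_rfl h (by simpa using hv0)
  rw [hf 0 hQ] at this
  simpa using this

/-! ### The pencil -/

/-- A bounded perturbation shears the graph: that of `X(t)` is the preimage of that of `X₀` under
`(x, y) ↦ (x, y - t X₁ x)`. -/
theorem pencil_isClosed {X₀ : H →ₗ.[ℂ] K} (hc : X₀.IsClosed) (X₁ : H →L[ℂ] K) (t : ℝ) :
    (pencil X₀ X₁ t).IsClosed := by
  have hcont : Continuous fun p : H × K => (p.1, p.2 - (t : ℂ) • X₁ p.1) := by fun_prop
  have : ((pencil X₀ X₁ t).graph : Set (H × K)) =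
      (fun p : H × K => (p.1, p.2 - (t : ℂ) • X₁ p.1)) ⁻¹' X₀.graph := by
    ext ⟨x, y⟩
    simp only [SetLike.mem_coe, Set.mem_preimage, LinearPMap.mem_graph_iff]
    constructor
    · rintro ⟨z, rfl, h⟩
      refine ⟨z, rfl, ?_⟩
      rw [← h]
      exact (add_sub_cancel_left _ _).symm
    · rintro ⟨z, rfl, h⟩
      refine ⟨z, rfl, ?_⟩
      have h2 : (pencil X₀ X₁ t) z = (t : ℂ) • X₁ z + X₀ z := rfl
      rw [h2, h]; abel
  rw [LinearPMap.IsClosed, this]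
  exact hc.preimage hcont

theorem pencil_zero (X₀ : H →ₗ.[ℂ] K) (X₁ : H →L[ℂ] K) : pencil X₀ X₁ 0 = X₀ := by
  refine LinearPMap.ext rfl fun x => ?_
  intro h h2
  have : pencil X₀ X₁ 0 ⟨x, h⟩ = ((0 : ℝ) : ℂ) • X₁ x + X₀ ⟨x, h⟩ := rfl
  rw [this]; simp

/-! ### Orthogonality between the kernel of `X*` and the range of `X` -/

theorem mem_pker_of_inner_eq_zero {X : H →ₗ.[ℂ] K} (hX : Dense (X.domain : Set H)) {w : K}
    (hw : ∀ u : X.domain, ⟪w, X u⟫_ℂ = 0) : w ∈ pker X† := by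
  have hd : w ∈ X†.domain :=
    LinearPMap.mem_adjoint_domain_of_exists _ ⟨0, fun u => by rw [hw]; simp⟩
  exact ⟨⟨w, hd⟩, LinearMap.mem_ker.2 (LinearPMap.adjoint_apply_eq hX ⟨w, hd⟩
    fun u => by rw [hw]; simp), rfl⟩

theorem inner_eq_zero_of_mem_closure_pker_adjoint {X : H →ₗ.[ℂ] K}
    (hX : Dense (X.domain : Set H)) {w : K} (hw : w ∈ (pker X†).topologicalClosure)
    (u : X.domain) : ⟪X u, w⟫_ℂ = 0 := by
  have hcl : IsClosed {w : K | ⟪X u, w⟫_ℂ = 0} := isClosed_eq (by fun_prop) continuous_const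
  refine closure_minimal ?_ hcl (a := w) hw
  rintro _ ⟨w, hw, rfl⟩
  have h1 := LinearPMap.adjoint_isFormalAdjoint hX w u
  have h2 : X† w = 0 := hw
  rw [h2, inner_zero_left] at h1
  exact inner_eq_zero_symm.1 h1.symm

/-- The orthogonal complement of the range lies in `Ker X*`, so a vector orthogonal to `Ker X*` lies
in the double complement of the range, which is its closure. -/
theorem sub_orthProj_mem_closure_range {X : H →ₗ.[ℂ] K} (hX : Dense (X.domain : Set H))
    (y : K) : y - orthProj (pker X†) y ∈ closure (Set.range X) := by
  have h1 : y - orthProj (pker X†) y ∈ ((LinearMap.range X.toFun)ᗮ)ᗮ := by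
    rw [Submodule.mem_orthogonal]
    intro w hw
    have hw' : w ∈ (pker X†).topologicalClosure :=
      Submodule.le_topologicalClosure _ (mem_pker_of_inner_eq_zero hX fun u =>
        (Submodule.mem_orthogonal' _ _).1 hw _ ⟨u, rfl⟩)
    exact inner_eq_zero_symm.1
      (Submodule.starProjection_inner_eq_zero (K := (pker X†).topologicalClosure) y w hw')
  rw [Submodule.orthogonal_orthogonal_eq_closure] at h1
  exact h1

/-- A bounded family of functionals converging to zero on a set does so on its closure. -/
theorem tendsto_inner_zero_of_mem_closure {ι : Type*} {l : Filter ι} {ψ : ι → K} {M : ℝ}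
    (hψ : ∀ᶠ i in l, ‖ψ i‖ ≤ M) {s : Set K}
    (hs : ∀ y ∈ s, Tendsto (fun i => ⟪ψ i, y⟫_ℂ) l (𝓝 0)) {y : K} (hy : y ∈ closure s) :
    Tendsto (fun i => ⟪ψ i, y⟫_ℂ) l (𝓝 0) := by
  rw [Metric.tendsto_nhds]
  intro e he
  have hM : 0 < |M| + 1 := by positivity
  obtain ⟨z, hz, hyz⟩ := Metric.mem_closure_iff.1 hy (e / 2 / (|M| + 1)) (by positivity)
  filter_upwards [hψ, Metric.tendsto_nhds.1 (hs z hz) (e / 2) (by positivity)] with i h1 h2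
  rw [dist_zero_right] at h2 ⊢
  have h3 : ⟪ψ i, y⟫_ℂ = ⟪ψ i, y - z⟫_ℂ + ⟪ψ i, z⟫_ℂ := by rw [inner_sub_right]; ring
  rw [dist_eq_norm] at hyz
  have h4 : ‖⟪ψ i, y - z⟫_ℂ‖ ≤ e / 2 := by
    calc ‖⟪ψ i, y - z⟫_ℂ‖ ≤ ‖ψ i‖ * ‖y - z‖ := norm_inner_le_norm _ _
      _ ≤ (|M| + 1) * (e / 2 / (|M| + 1)) := by
        gcongr
        exact h1.trans ((le_abs_self M).trans (by linarith))
      _ = e / 2 := by field_simp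
  rw [h3]
  linarith [norm_add_le ⟪ψ i, y - z⟫_ℂ ⟪ψ i, z⟫_ℂ]

/-! ### Eigenvalues of the germ -/

/-- For a normalized eigenvector `v` of `A(t)`, the vector `y = t⁻¹ X(t) v`. -/
theorem exists_scaled_image {X₀ : H →ₗ.[ℂ] K} (hX : Dense (X₀.domain : Set H)) {X₁ : H →L[ℂ] K}
    {t : ℝ} (ht : t ≠ 0) {x : ℝ} {v : H} (hv1 : ‖v‖ = 1) (hv : v ∈ (opA X₀ X₁ t).domain)
    (hev : opA X₀ X₁ t ⟨v, hv⟩ = (x : ℂ) • v) :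
    ∃ y : K, ‖y‖ ^ 2 = x / t ^ 2 ∧
      (∀ ζ : X₀.domain, ⟪y, X₀ ζ + (t : ℂ) • X₁ ζ⟫_ℂ = ((x / t : ℝ) : ℂ) * ⟪v, (ζ : H)⟫_ℂ) ∧
      ∀ w ∈ (pker X₀†).topologicalClosure, ⟪y, w⟫_ℂ = ⟪X₁ v, w⟫_ℂ := by
  obtain ⟨h, hin⟩ := gram_inner (X := pencil X₀ X₁ t) hX ⟨v, hv⟩
  have hev' : gram (pencil X₀ X₁ t) ⟨v, hv⟩ = (x : ℂ) • v := hev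
  have h' : v ∈ X₀.domain := h
  have ht' : (t : ℂ) ≠ 0 := Complex.ofReal_ne_zero.2 ht
  have hp : ∀ ζ : X₀.domain, pencil X₀ X₁ t ζ = X₀ ζ + (t : ℂ) • X₁ ζ := fun ζ =>
    add_comm ((t : ℂ) • X₁ ζ) (X₀ ζ)
  have hin' : ∀ ζ : X₀.domain, ⟪X₀ ⟨v, h'⟩ + (t : ℂ) • X₁ v, X₀ ζ + (t : ℂ) • X₁ ζ⟫_ℂ =
      (x : ℂ) * ⟪v, (ζ : H)⟫_ℂ := by
    intro ζ
    rw [← hp ζ, ← hp ⟨v, h'⟩]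
    refine (hin ζ).symm.trans ?_
    rw [hev', inner_smul_left, Complex.conj_ofReal]
  refine ⟨((t⁻¹ : ℝ) : ℂ) • (X₀ ⟨v, h'⟩ + (t : ℂ) • X₁ v), ?_, fun ζ => ?_, fun w hw => ?_⟩
  · have h1 := hin' ⟨v, h'⟩
    rw [inner_self_eq_norm_sq_to_K, inner_self_eq_norm_sq_to_K, hv1] at h1
    have h2 : ‖X₀ ⟨v, h'⟩ + (t : ℂ) • X₁ v‖ ^ 2 = x := by
      simp only [Complex.coe_algebraMap] at h1
      exact_mod_cast (by simpa using h1 :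
        ((‖X₀ ⟨v, h'⟩ + (t : ℂ) • X₁ v‖ : ℝ) : ℂ) ^ 2 = (x : ℂ))
    rw [norm_smul, mul_pow, h2, Complex.norm_real, Real.norm_eq_abs, sq_abs]
    field_simp
  · rw [inner_smul_left, hin', Complex.conj_ofReal, ← mul_assoc]
    congr 1
    push_cast
    field_simp
  · rw [inner_smul_left, inner_add_left, inner_eq_zero_of_mem_closure_pker_adjoint hX hw,
      inner_smul_left, Complex.conj_ofReal, Complex.conj_ofReal, zero_add, ← mul_assoc]
    push_cast
    rw [inv_mul_cancel₀ ht', one_mul]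

theorem orthProj_inner_left (N : Submodule ℂ H) (u v : H) :
    ⟪orthProj N u, v⟫_ℂ = ⟪u, orthProj N v⟫_ℂ :=
  Submodule.inner_starProjection_left_eq_right _ u v

theorem orthProj_orthProj (N : Submodule ℂ H) (u : H) :
    orthProj N (orthProj N u) = orthProj N u :=
  Submodule.starProjection_eq_self_iff.2 (Submodule.starProjection_apply_mem _ u)

theorem orthProj_mem (N : Submodule ℂ H) (u : H) : orthProj N u ∈ N.topologicalClosure :=
  Submodule.starProjection_apply_mem _ u

theorem orthProj_of_mem {N : Submodule ℂ H} {u : H} (hu : u ∈ N) : orthProj N u = u :=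
  Submodule.starProjection_eq_self_iff.2 (Submodule.le_topologicalClosure _ hu)

theorem inner_germ {X₀ : H →ₗ.[ℂ] K} {X₁ : H →L[ℂ] K} {ω : H} (hω : ω ∈ pker X₀) (v : H) :
    ⟪germ X₀ X₁ ω, v⟫_ℂ =
      ⟪X₁ ω, orthProj (pker X₀†) (X₁ (orthProj (pker X₀) v))⟫_ℂ := by
  rw [germ, ContinuousLinearMap.comp_apply, ContinuousLinearMap.adjoint_inner_left]
  simp only [opRP, ContinuousLinearMap.comp_apply, orthProj_of_mem hω]
  rw [orthProj_inner_left, orthProj_orthProj]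

/-- If `λ(t) = γ t² + o(t²)` and `φ(t)` are an eigenvalue and a normalized eigenvector of `A(t)`,
with `φ(0)` in the kernel of `X₀`, then `S φ(0) = γ φ(0)`. -/
theorem germ_apply_of_tendsto {X₀ : H →ₗ.[ℂ] K} (hX : Dense (X₀.domain : Set H))
    (X₁ : H →L[ℂ] K) (hN : IsClosed (pker X₀ : Set H)) {φ : ℝ → H} {lam : ℝ → ℝ} {γ : ℝ}
    (hφ : ContinuousAt φ 0) (hω : φ 0 ∈ pker X₀)
    (hev : ∀ᶠ t in 𝓝 (0 : ℝ), ‖φ t‖ = 1 ∧ ∃ h : φ t ∈ (opA X₀ X₁ t).domain,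
      opA X₀ X₁ t ⟨φ t, h⟩ = (lam t : ℂ) • φ t)
    (hlam : Tendsto (fun t => lam t / t ^ 2) (𝓝[≠] 0) (𝓝 γ)) :
    germ X₀ X₁ (φ 0) = (γ : ℂ) • φ 0 := by
  have hex : ∀ᶠ t in 𝓝[≠] (0 : ℝ), ∃ y : K, ‖y‖ ^ 2 = lam t / t ^ 2 ∧
      (∀ ζ : X₀.domain, ⟪y, X₀ ζ + (t : ℂ) • X₁ ζ⟫_ℂ =
        ((lam t / t : ℝ) : ℂ) * ⟪φ t, (ζ : H)⟫_ℂ) ∧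
      ∀ w ∈ (pker X₀†).topologicalClosure, ⟪y, w⟫_ℂ = ⟪X₁ (φ t), w⟫_ℂ := by
    filter_upwards [nhdsWithin_le_nhds hev, self_mem_nhdsWithin] with t ⟨h1, h2, h3⟩ h0
    exact exists_scaled_image hX h0 h1 h2 h3
  -- `ψ t` is the vector `t⁻¹ X(t) φ(t)`. It is bounded, asymptotically orthogonal to the range of
  -- `X₀`, and has the same pairing with `𝔑_*` as `X₁ φ(t)`.
  obtain ⟨ψ, hψ⟩ := hex.choice
  have hφ' : Tendsto φ (𝓝[≠] 0) (𝓝 (φ 0)) := hφ.tendsto.mono_left nhdsWithin_le_nhds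
  have ht : Tendsto (fun t : ℝ => (t : ℂ)) (𝓝[≠] 0) (𝓝 0) := by
    have := Complex.continuous_ofReal.tendsto 0
    rw [Complex.ofReal_zero] at this
    exact this.mono_left nhdsWithin_le_nhds
  have hlam' : Tendsto (fun t => ((lam t / t ^ 2 : ℝ) : ℂ)) (𝓝[≠] 0) (𝓝 (γ : ℂ)) :=
    (Complex.continuous_ofReal.tendsto γ).comp hlam
  have hM : ∀ᶠ t in 𝓝[≠] (0 : ℝ), ‖ψ t‖ ≤ γ + 2 := by
    filter_upwards [hψ, hlam.eventually_le_const (lt_add_one γ)] with t ⟨h1, _⟩ h2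
    rw [← h1] at h2
    nlinarith [sq_nonneg (‖ψ t‖ - 1)]
  -- Here `⟪ψ, X₀ζ⟫ = t((λ/t²)⟪φ, ζ⟫ - ⟪ψ, X₁ζ⟫)`, with a bounded bracket.
  have hrange : ∀ y ∈ Set.range X₀, Tendsto (fun t => ⟪ψ t, y⟫_ℂ) (𝓝[≠] 0) (𝓝 0) := by
    rintro _ ⟨ζ, rfl⟩
    have h1 : Tendsto (fun t : ℝ => (t : ℂ) *
        (((lam t / t ^ 2 : ℝ) : ℂ) * ⟪φ t, (ζ : H)⟫_ℂ)) (𝓝[≠] 0) (𝓝 0) := by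
      have := ht.mul (hlam'.mul (hφ'.inner (𝕜 := ℂ) (tendsto_const_nhds (x := (ζ : H)))))
      rwa [zero_mul] at this
    have h2 : Tendsto (fun t : ℝ => (t : ℂ) * ⟪ψ t, X₁ ζ⟫_ℂ) (𝓝[≠] 0) (𝓝 0) := by
      refine ht.zero_mul_isBoundedUnder_le
        ⟨(γ + 2) * ‖X₁ ζ‖, eventually_map.2 ?_⟩
      filter_upwards [hM] with t h
      exact (norm_inner_le_norm _ _).trans (by gcongr)
    have h3 := h1.sub h2
    rw [sub_zero] at h3
    refine h3.congr' ?_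
    filter_upwards [hψ, self_mem_nhdsWithin] with t ⟨_, h, _⟩ h0
    have h0' : (t : ℂ) ≠ 0 := Complex.ofReal_ne_zero.2 h0
    have := h ζ
    rw [inner_add_right, inner_smul_right] at this
    rw [sub_eq_iff_eq_add, this]
    push_cast
    field_simp
  -- For `ζ ∈ 𝔑` the weak equation reads `⟪ψ, X₁ζ⟫ = (λ/t²)⟪φ, ζ⟫`. Split `X₁ζ` into its `P_*` part
  -- and a part in the closure of the range of `X₀`; the latter contributes nothing in the limit.
  have key : ∀ ζ ∈ pker X₀, ⟪X₁ (φ 0), orthProj (pker X₀†) (X₁ ζ)⟫_ℂ = γ * ⟪φ 0, ζ⟫_ℂ := by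
    intro ζ hζ
    have h1 := tendsto_inner_zero_of_mem_closure hM hrange
      (sub_orthProj_mem_closure_range hX (X₁ ζ))
    have h2 : Tendsto (fun t => ⟪X₁ (φ t), orthProj (pker X₀†) (X₁ ζ)⟫_ℂ) (𝓝[≠] 0)
        (𝓝 ⟪X₁ (φ 0), orthProj (pker X₀†) (X₁ ζ)⟫_ℂ) :=
      ((X₁.continuous.tendsto _).comp hφ').inner tendsto_const_nhds
    have h3 := h1.add h2
    rw [zero_add] at h3
    have h4 := hlam'.mul (hφ'.inner (𝕜 := ℂ) (tendsto_const_nhds (x := ζ)))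
    refine tendsto_nhds_unique h3 (h4.congr' ?_)
    filter_upwards [hψ, self_mem_nhdsWithin] with t ⟨_, h, h'⟩ h0
    have h0' : (t : ℂ) ≠ 0 := Complex.ofReal_ne_zero.2 h0
    obtain ⟨z, hz, rfl⟩ := hζ
    have hz' : X₀ z = 0 := hz
    have h5 := h z
    rw [hz', zero_add, inner_smul_right] at h5
    rw [← h' _ (orthProj_mem _ _), ← inner_add_right, sub_add_cancel]
    refine mul_left_cancel₀ h0' (Eq.trans ?_ h5.symm)
    push_cast
    simp only [Submodule.coe_subtype]
    field_simp
  refine ext_inner_right ℂ fun v => ?_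
  have hv : orthProj (pker X₀) v ∈ pker X₀ := by
    have := orthProj_mem (pker X₀) v
    rwa [IsClosed.submodule_topologicalClosure_eq hN] at this
  rw [inner_germ hω, key _ hv, ← orthProj_inner_left, orthProj_of_mem hω, inner_smul_left,
    Complex.conj_ofReal]

/-! ### Asymptotics of the eigenvalues -/

theorem isBigO_sub_taylor_three {f : ℝ → ℝ} (hf : AnalyticAt ℝ f 0) (h0 : f 0 = 0)
    (h1 : deriv f 0 = 0) :
    (fun t => f t - (iteratedDeriv 2 f 0 / 2 * t ^ 2 + iteratedDeriv 3 f 0 / 6 * t ^ 3))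
      =O[𝓝 0] fun t : ℝ => t ^ 4 := by
  have h := hf.hasFPowerSeriesAt.isBigO_sub_partialSum_pow 4
  simp only [zero_add, FormalMultilinearSeries.partialSum, Finset.sum_range_succ,
    Finset.sum_range_zero, FormalMultilinearSeries.ofScalars_apply_eq, smul_eq_mul,
    iteratedDeriv_zero, iteratedDeriv_one, h0, h1] at h
  refine (h.congr_left fun t => ?_).trans (Asymptotics.isBigO_of_le _ fun t => by simp)
  norm_num [Nat.factorial]

theorem tendsto_sub_div_cube {f : ℝ → ℝ} {γ μ : ℝ}
    (hf : (fun t => f t - (γ * t ^ 2 + μ * t ^ 3)) =O[𝓝 0] fun t : ℝ => t ^ 4) :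
    Tendsto (fun t => (f t - γ * t ^ 2) / t ^ 3) (𝓝[≠] 0) (𝓝 μ) := by
  have h1 : (fun t => f t - (γ * t ^ 2 + μ * t ^ 3)) =o[𝓝[≠] 0] fun t : ℝ => t ^ 3 :=
    (hf.trans_isLittleO (Asymptotics.isLittleO_pow_pow (by norm_num))).mono nhdsWithin_le_nhds
  have h2 := h1.tendsto_div_nhds_zero.add_const μ
  rw [zero_add] at h2
  refine h2.congr' ?_
  filter_upwards [self_mem_nhdsWithin] with t ht
  have ht' : t ≠ 0 := ht
  field_simp
  ring

theorem tendsto_div_sq_of_tendsto_sub_div_cube {f : ℝ → ℝ} {γ μ : ℝ}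
    (hf : Tendsto (fun t => (f t - γ * t ^ 2) / t ^ 3) (𝓝[≠] 0) (𝓝 μ)) :
    Tendsto (fun t => f t / t ^ 2) (𝓝[≠] 0) (𝓝 γ) := by
  have ht : Tendsto (fun t : ℝ => t) (𝓝[≠] 0) (𝓝 0) := nhdsWithin_le_nhds
  have h := (hf.mul ht).add_const γ
  rw [mul_zero, zero_add] at h
  refine h.congr' ?_
  filter_upwards [self_mem_nhdsWithin] with t ht
  have ht' : t ≠ 0 := ht
  field_simp
  ring

/-- Rationalize: the quotient is `(f - γt²)/t³` divided by `√(f/t²) + √γ`. The limit is one-sided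
because `√(t²) = t` requires `t > 0`. -/
theorem tendsto_sqrt_sub_div_sq {f : ℝ → ℝ} {γ μ : ℝ} (hγ : 0 < γ)
    (hf : Tendsto (fun t => (f t - γ * t ^ 2) / t ^ 3) (𝓝[≠] 0) (𝓝 μ)) :
    Tendsto (fun t => (√(f t) - t * √γ) / t ^ 2) (𝓝[>] 0) (𝓝 (μ / (2 * √γ))) := by
  have hle : 𝓝[>] (0 : ℝ) ≤ 𝓝[≠] 0 := nhdsWithin_mono _ fun t ht => (Set.mem_Ioi.1 ht).ne'
  have h2 := (tendsto_div_sq_of_tendsto_sub_div_cube hf).mono_left hle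
  have hs : Tendsto (fun t => √(f t / t ^ 2) + √γ) (𝓝[>] 0) (𝓝 (2 * √γ)) := by
    have := ((Real.continuous_sqrt.tendsto γ).comp h2).add_const √γ
    rwa [← two_mul] at this
  have hγ' : 0 < √γ := Real.sqrt_pos.2 hγ
  refine ((hf.mono_left hle).div hs (by positivity)).congr' ?_
  filter_upwards [self_mem_nhdsWithin, h2.eventually_const_lt hγ] with t ht hpos
  have ht' : 0 < t := ht
  have hfp : 0 ≤ f t := by
    have := (div_pos_iff_of_pos_right (by positivity : 0 < t ^ 2)).1 hpos
    exact this.le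
  simp only [Pi.div_apply]
  rw [Real.sqrt_div hfp, Real.sqrt_sq ht'.le]
  have e1 := Real.sq_sqrt hfp
  have e2 := Real.sq_sqrt hγ.le
  have hne : √(f t) / t + √γ ≠ 0 := by positivity
  rw [div_eq_iff hne]
  field_simp
  linear_combination -e1 + t ^ 2 * e2

/-! ### The choice of the parameters -/

/-- At `ε = θt²` the weight `ε^s(t²+ε²)^(-s/2)` equals `θ^s t^s (1+θ²t²)^(-s/2)`; dividing it out of
`Cε` leaves order `t^(2-s)`. -/
theorem le_of_mul_weight_le {N C θ s t : ℝ} (hθ : 0 < θ) (ht : 0 < t)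
    (h : N * ((θ * t ^ 2) ^ s * (t ^ 2 + (θ * t ^ 2) ^ 2) ^ (-s / 2)) ≤ C * (θ * t ^ 2)) :
    N ≤ C * θ * θ ^ (-s) * (t ^ (2 - s) * (1 + θ ^ 2 * t ^ 2) ^ (s / 2)) := by
  have e1 : t ^ 2 + (θ * t ^ 2) ^ 2 = t ^ 2 * (1 + θ ^ 2 * t ^ 2) := by ring
  have hp : 0 < 1 + θ ^ 2 * t ^ 2 := by positivity
  have e2 : (t ^ 2) ^ (-s / 2) = t ^ (-s) := by
    rw [← Real.rpow_natCast t 2, ← Real.rpow_mul ht.le]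
    congr 1; push_cast; ring
  have e3 : (t ^ 2) ^ s = t ^ s * t ^ s := by
    rw [← Real.rpow_natCast t 2, ← Real.rpow_mul ht.le, ← Real.rpow_add ht]
    congr 1; push_cast; ring
  rw [e1, Real.mul_rpow hθ.le (by positivity), Real.mul_rpow (by positivity) hp.le, e2, e3,
    neg_div, Real.rpow_neg hp.le, Real.rpow_neg ht.le] at h
  rw [Real.rpow_sub ht, Real.rpow_neg hθ.le, Real.rpow_two]
  have q1 : 0 < t ^ s := Real.rpow_pos_of_pos ht s
  have q2 : 0 < θ ^ s := Real.rpow_pos_of_pos hθ s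
  have q3 : 0 < (1 + θ ^ 2 * t ^ 2) ^ (s / 2) := Real.rpow_pos_of_pos hp _
  have e4 : θ ^ s * (t ^ s * t ^ s) * ((t ^ s)⁻¹ * ((1 + θ ^ 2 * t ^ 2) ^ (s / 2))⁻¹) =
      θ ^ s * t ^ s / (1 + θ ^ 2 * t ^ 2) ^ (s / 2) := by field_simp
  rw [e4, ← le_div_iff₀ (by positivity)] at h
  refine h.trans (le_of_eq ?_)
  field_simp

theorem tendsto_weight {s θ : ℝ} (hs : s < 2) :
    Tendsto (fun t : ℝ => t ^ (2 - s) * (1 + θ ^ 2 * t ^ 2) ^ (s / 2)) (𝓝 0) (𝓝 0) := by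
  have h1 : Tendsto (fun t : ℝ => t ^ (2 - s)) (𝓝 0) (𝓝 0) := by
    have := (Real.continuousAt_rpow_const 0 (2 - s) (Or.inr (by linarith))).tendsto
    rwa [Real.zero_rpow (by linarith)] at this
  have h2 : ContinuousAt (fun t : ℝ => (1 + θ ^ 2 * t ^ 2) ^ (s / 2)) 0 :=
    ContinuousAt.rpow_const (by fun_prop) (Or.inl (by norm_num))
  have := h1.mul h2.tendsto
  rwa [zero_mul] at this

/-- There are `t → 0` and `ε = θ t²` such that `cos(ε⁻¹ τ t √γ) = 1`, whereas
`cos(ε⁻¹ τ √(f t)) → -1`. -/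
theorem exists_sequence_cos {f : ℝ → ℝ} {γ μ τ : ℝ} (hγ : 0 < γ) (hμ : μ ≠ 0) (hτ : τ ≠ 0)
    (hf : Tendsto (fun t => (f t - γ * t ^ 2) / t ^ 3) (𝓝[≠] 0) (𝓝 μ)) :
    ∃ θ : ℝ, 0 < θ ∧ ∃ t : ℕ → ℝ, (∀ k, 0 < t k) ∧ Tendsto t atTop (𝓝 0) ∧
      (∀ k, Real.cos ((θ * t k ^ 2)⁻¹ * τ * √(t k ^ 2 * γ)) = 1) ∧
      Tendsto (fun k => Real.cos ((θ * t k ^ 2)⁻¹ * τ * √(f (t k)))) atTop (𝓝 (-1)) := by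
  have hγ' : 0 < √γ := Real.sqrt_pos.2 hγ
  have hμ' : 0 < |μ| := abs_pos.2 hμ
  have hτ' : 0 < |τ| := abs_pos.2 hτ
  have hπ := Real.pi_pos
  -- Evenness of the cosine removes the sign of `τ`, so that `θ` can be positive.
  have hcos : ∀ {a b : ℝ}, Real.cos (a * τ * b) = Real.cos (a * |τ| * b) := by
    intro a b
    rcases abs_choice τ with h | h <;> rw [h]
    rw [← Real.cos_neg]; congr 1; ring
  -- Solves `|τ||μ|/(2θ√γ) = π`, the limiting phase shift.
  set θ := |τ| * |μ| / (2 * Real.pi * √γ) with hθ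
  have hθ0 : 0 < θ := by positivity
  -- With this `θ` the unperturbed phase is `2πγ/(|μ|t)`; setting it equal to `2π(k+1)` gives `t k`.
  set t : ℕ → ℝ := fun k => γ / |μ| / ((k : ℝ) + 1) with ht
  have ht0 : ∀ k, 0 < t k := fun k => by positivity
  have htt : Tendsto t atTop (𝓝 0) := by
    have := (tendsto_one_div_add_atTop_nhds_zero_nat (𝕜 := ℝ)).const_mul (γ / |μ|)
    rw [mul_zero] at this
    exact this.congr fun k => by rw [ht]; simp only; ring
  have hphase : ∀ k, (θ * t k ^ 2)⁻¹ * |τ| * (t k * √γ) = ((k + 1 : ℕ) : ℝ) * (2 * Real.pi) := by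
    intro k
    have e2 := Real.sq_sqrt hγ.le
    rw [hθ, ht]
    simp only
    push_cast
    field_simp
    linear_combination e2
  refine ⟨θ, hθ0, t, ht0, htt, fun k => ?_, ?_⟩
  · rw [hcos, Real.sqrt_mul (sq_nonneg _), Real.sqrt_sq (ht0 k).le, hphase]
    exact Real.cos_nat_mul_two_pi _
  · have htt' : Tendsto t atTop (𝓝[>] 0) :=
      tendsto_nhdsWithin_iff.2 ⟨htt, Eventually.of_forall ht0⟩
    have h1 := ((tendsto_sqrt_sub_div_sq hγ hf).comp htt').const_mul (|τ| / θ)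
    have h2 : Real.cos (|τ| / θ * (μ / (2 * √γ))) = -1 := by
      rw [← Real.cos_abs, ← Real.cos_pi]
      congr 1
      rw [abs_mul, abs_of_pos (div_pos hτ' hθ0), abs_div,
        abs_of_pos (by positivity : 0 < 2 * √γ), hθ]
      field_simp
    rw [← h2]
    refine ((Real.continuous_cos.tendsto _).comp h1).congr fun k => ?_
    have hk := ht0 k
    rw [hcos, ← Real.cos_sub_nat_mul_two_pi _ (k + 1), ← hphase]
    simp only [Function.comp_apply]
    congr 1
    field_simp

/-! ### Branches at `t = 0` -/

section Branches

variable {X₀ : H →ₗ.[ℂ] K} {X₁ : H →L[ℂ] K} {δ t₀ : ℝ} {n : ℕ} {lam : Fin n → ℝ → ℝ}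
  {φ : Fin n → ℝ → H}

/-- `𝔑` is contained in the span of the `φ_l(0)`, and both have dimension `n`, so they coincide. -/
theorem IsBranchSystem.mem_pker (hb : IsBranchSystem X₀ X₁ δ t₀ lam φ)
    (hX : Dense (X₀.domain : Set H)) (hc : X₀.IsClosed)
    (hdim : Module.finrank ℂ (pker X₀) = n) (hδ : 0 ≤ δ) (ht₀ : 0 ≤ t₀) (l : Fin n) :
    φ l 0 ∈ pker X₀ := by
  have h0 : (0 : ℝ) ∈ Set.Icc (-t₀) t₀ := ⟨by linarith, ht₀⟩
  have hle : pker X₀ ≤ Submodule.span ℂ (Set.range fun l => φ l 0) := by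
    rw [hb.span 0 h0, opA, pencil_zero]
    exact pker_le_spectralSubspace hX hc ⟨le_rfl, hδ⟩
  have : FiniteDimensional ℂ (Submodule.span ℂ (Set.range fun l => φ l 0)) :=
    FiniteDimensional.span_of_finite ℂ (Set.finite_range _)
  have heq := Submodule.eq_of_le_of_finrank_eq hle (by
    rw [hdim, finrank_span_eq_card (hb.orthonormal 0 h0).linearIndependent, Fintype.card_fin])
  rw [heq]
  exact Submodule.subset_span ⟨l, rfl⟩

theorem IsBranchSystem.lam_zero (hb : IsBranchSystem X₀ X₁ δ t₀ lam φ)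
    (hX : Dense (X₀.domain : Set H)) (ht₀ : 0 ≤ t₀) {l : Fin n} (hl : φ l 0 ∈ pker X₀) :
    lam l 0 = 0 := by
  have h0 : (0 : ℝ) ∈ Set.Icc (-t₀) t₀ := ⟨by linarith, ht₀⟩
  obtain ⟨h, he⟩ := hb.eigen l 0 h0
  obtain ⟨h', he'⟩ := gram_eigenvector_of_mem_pker (X := pencil X₀ X₁ 0) hX
    (by rw [pencil_zero]; exact hl)
  have h1 : (lam l 0 : ℂ) • φ l 0 = 0 := he.symm.trans he'
  have hne : φ l 0 ≠ 0 := (hb.orthonormal 0 h0).ne_zero l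
  exact Complex.ofReal_eq_zero.1 ((smul_eq_zero.1 h1).resolve_right hne)

theorem IsBranchSystem.le_lam (hb : IsBranchSystem X₀ X₁ δ t₀ lam φ) {c : ℝ}
    (hnondeg : ∀ t : ℝ, |t| ≤ t₀ → ∀ u : (opA X₀ X₁ t).domain,
      c * t ^ 2 * ‖(u : H)‖ ^ 2 ≤ (inner ℂ (opA X₀ X₁ t u) (u : H)).re)
    (l : Fin n) {t : ℝ} (ht : t ∈ Set.Icc (-t₀) t₀) : c * t ^ 2 ≤ lam l t := by
  obtain ⟨h, he⟩ := hb.eigen l t ht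
  have h1 := hnondeg t (abs_le.2 ht) ⟨_, h⟩
  have hn : ‖φ l t‖ = 1 := (hb.orthonormal t ht).1 l
  rw [he, inner_smul_left, Complex.conj_ofReal, inner_self_eq_norm_sq_to_K, hn] at h1
  simpa [hn] using h1

theorem exists_mu_ne_zero (hN₀ : opN₀ lam φ ≠ 0) : ∃ l, mu lam l ≠ 0 := by
  by_contra! h
  exact hN₀ (by simp [opN₀, h])

end Branches

/-- If `A(t) v' = x v'`, `S ω = γ ω` with unit vectors `v'`, `ω ∈ 𝔑`, then the difference of the
cosines at the eigenvalues is controlled by the operator difference and by `‖v' - ω‖`. -/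
theorem abs_cos_sub_cos_le {X₀ : H →ₗ.[ℂ] K} (hX : Dense (X₀.domain : Set H))
    (hc : X₀.IsClosed) {X₁ : H →L[ℂ] K} (r t : ℝ) {x γ : ℝ} (hx : 0 ≤ x) {v ω : H}
    (hv1 : ‖v‖ = 1) (hω1 : ‖ω‖ = 1) (hω : ω ∈ pker X₀) (hv : v ∈ (opA X₀ X₁ t).domain)
    (hev : opA X₀ X₁ t ⟨v, hv⟩ = (x : ℂ) • v) (hγ : germ X₀ X₁ ω = (γ : ℂ) • ω) :
    |Real.cos (r * √x) - Real.cos (r * √(t ^ 2 * γ))| ≤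
      ‖cosSqrt r (opA X₀ X₁ t) ∘L orthProj (pker X₀) -
        cosSqrtBdd r (t ^ 2 • germ X₀ X₁) ∘L orthProj (pker X₀)‖ + 2 * ‖v - ω‖ := by
  set D := cosSqrt r (opA X₀ X₁ t) ∘L orthProj (pker X₀) -
        cosSqrtBdd r (t ^ 2 • germ X₀ X₁) ∘L orthProj (pker X₀) with hD
  set A := cosSqrt r (opA X₀ X₁ t) with hA
  have hX' : Dense ((pencil X₀ X₁ t).domain : Set H) := hX
  have hc' := pencil_isClosed hc X₁ t
  have hAn : ‖A‖ ≤ 1 := norm_cosSqrt_le_one hX' hc' r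
  have hAv : A v = (Real.cos (r * √x) : ℂ) • v := cosSqrt_apply_of_eigenvector hX' hc' r hx hv hev
  have hsa : IsSelfAdjoint (t ^ 2 • germ X₀ X₁) := by
    have h : IsSelfAdjoint (germ X₀ X₁) := 
      (ContinuousLinearMap.isPositive_adjoint_comp_self (opRP X₀ X₁)).isSelfAdjoint
    exact IsSelfAdjoint.smul (IsSelfAdjoint.all _) h
  have hB : cosSqrtBdd r (t ^ 2 • germ X₀ X₁) ω = (Real.cos (r * √(t ^ 2 * γ)) : ℂ) • ω := by
    refine cfc_apply_of_eigenvector hsa (x := t ^ 2 * γ) ?_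
      (continuous_cos_mul_sqrt r).continuousOn
    rw [smul_apply, hγ, ← Complex.coe_smul, smul_smul, Complex.ofReal_mul]
  have hDω : D ω = A ω - (Real.cos (r * √(t ^ 2 * γ)) : ℂ) • ω := by
    rw [hD, sub_apply, ContinuousLinearMap.comp_apply, ContinuousLinearMap.comp_apply,
      orthProj_of_mem hω, hB]
  -- Write `a`, `b` for the two cosines: `Av = av` and `Dω = Aω - bω` give `(a - b)v = Dω + (A -
  -- b)(v - ω)`.
  have hid : ((Real.cos (r * √x) - Real.cos (r * √(t ^ 2 * γ)) : ℝ) : ℂ) • v =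
      D ω + (A (v - ω) - (Real.cos (r * √(t ^ 2 * γ)) : ℂ) • (v - ω)) := by
    rw [hDω, map_sub, hAv, Complex.ofReal_sub, sub_smul, smul_sub]
    abel
  have h1 := congrArg norm hid
  rw [norm_smul, hv1, mul_one, Complex.norm_real, Real.norm_eq_abs] at h1
  have h2 : ‖D ω‖ ≤ ‖D‖ := by simpa [hω1] using D.le_opNorm ω
  have h3 : ‖A (v - ω)‖ ≤ ‖v - ω‖ := by
    simpa using A.le_of_opNorm_le hAn (v - ω)
  have h4 : ‖(Real.cos (r * √(t ^ 2 * γ)) : ℂ) • (v - ω)‖ ≤ ‖v - ω‖ := by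
    rw [norm_smul, Complex.norm_real, Real.norm_eq_abs]
    exact mul_le_of_le_one_left (norm_nonneg _) (Real.abs_cos_le_one _)
  rw [h1]
  linarith [norm_add_le (D ω) (A (v - ω) - (Real.cos (r * √(t ^ 2 * γ)) : ℂ) • (v - ω)),
    norm_sub_le (A (v - ω)) ((Real.cos (r * √(t ^ 2 * γ)) : ℂ) • (v - ω))]

end QuadPencil

end

theorem mainTheorem7
    {H K : Type*}
    [NormedAddCommGroup H] [InnerProductSpace ℂ H] [CompleteSpace H]
    [TopologicalSpace.SeparableSpace H]
    [NormedAddCommGroup K] [InnerProductSpace ℂ K] [CompleteSpace K]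
    [TopologicalSpace.SeparableSpace K]
    -- the pencil `X(t) = X₀ + t X₁`
    (X₀ : H →ₗ.[ℂ] K) (hdense : Dense (X₀.domain : Set H)) (hclosed : X₀.IsClosed)
    (X₁ : H →L[ℂ] K)
    -- `0` is an isolated point of the spectrum of `A₀`, `0 < n = dim 𝔑 < ∞`, `n ≤ n_*`
    (n : ℕ) (hn : 0 < n) (hdim : Module.finrank ℂ (QuadPencil.pker X₀) = n)
    (hspec : (0 : ℂ) ∈ QuadPencil.pspectrum (QuadPencil.gram X₀))
    (hisol : ∃ r : ℝ, 0 < r ∧ ∀ z ∈ QuadPencil.pspectrum (QuadPencil.gram X₀), z ≠ 0 → r ≤ ‖z‖)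
    (hdim' : (n : Cardinal) ≤ Module.rank ℂ (QuadPencil.pker X₀.adjoint))
    -- `8 δ < d⁰`, `0 < t⁰ ≤ δ^{1/2} ‖X₁‖⁻¹`
    (δ : ℝ) (hδ : 0 < δ)
    (hδd : ENNReal.ofReal (8 * δ) <
      Metric.infEDist (0 : ℂ) (QuadPencil.pspectrum (QuadPencil.gram X₀) \ {0}))
    (t₀ : ℝ) (ht₀ : 0 < t₀) (ht₀X : t₀ * ‖X₁‖ ≤ √δ)
    -- `A(t) ≥ c_* t² I` for `|t| ≤ t⁰`
    (c : ℝ) (hc : 0 < c)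
    (hnondeg : ∀ t : ℝ, |t| ≤ t₀ → ∀ u : (QuadPencil.opA X₀ X₁ t).domain,
      c * t ^ 2 * ‖(u : H)‖ ^ 2 ≤ (inner ℂ (QuadPencil.opA X₀ X₁ t u) (u : H)).re)
    -- the analytic branches, and `N₀ ≠ 0`
    (lam : Fin n → ℝ → ℝ) (φ : Fin n → ℝ → H)
    (hbranch : QuadPencil.IsBranchSystem X₀ X₁ δ t₀ lam φ)
    (hN₀ : QuadPencil.opN₀ lam φ ≠ 0)
    (τ : ℝ) (hτ : τ ≠ 0) (s : ℝ) (hs₀ : 0 ≤ s) (hs : s < 2) :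
    ¬ ∃ C : ℝ, 0 < C ∧ ∃ η : ℝ, 0 < η ∧ ∀ t ε : ℝ, |t| < η → 0 < ε → ε < η →
      ‖QuadPencil.cosSqrt (ε⁻¹ * τ) (QuadPencil.opA X₀ X₁ t) ∘L
            QuadPencil.orthProj (QuadPencil.pker X₀) -
          QuadPencil.cosSqrtBdd (ε⁻¹ * τ) (t ^ 2 • QuadPencil.germ X₀ X₁) ∘L
            QuadPencil.orthProj (QuadPencil.pker X₀)‖ *
          (ε ^ s * (t ^ 2 + ε ^ 2) ^ (-s / 2)) ≤ C * ε := by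
  open QuadPencil Filter Topology in
  rintro ⟨C, -, η, hη, hest⟩
  obtain ⟨l, hl⟩ := exists_mu_ne_zero hN₀
  have h0 : (0 : ℝ) ∈ Set.Icc (-t₀) t₀ := ⟨by linarith, ht₀.le⟩
  have hnhds : Set.Icc (-t₀) t₀ ∈ 𝓝 (0 : ℝ) := Icc_mem_nhds (by linarith) ht₀
  have hω := hbranch.mem_pker hdense hclosed hdim hδ.le ht₀.le l
  have hlam0 := hbranch.lam_zero hdense ht₀.le hω
  have hle : ∀ t ∈ Set.Icc (-t₀) t₀, c * t ^ 2 ≤ lam l t := fun t =>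
    hbranch.le_lam hnondeg l
  have hpos : ∀ t ∈ Set.Icc (-t₀) t₀, 0 ≤ lam l t := fun t ht =>
    (by positivity : 0 ≤ c * t ^ 2).trans (hle t ht)
  have hanal : AnalyticAt ℝ (lam l) 0 := (hbranch.analytic_lam l).analyticAt hnhds
  have hcont : ContinuousAt (φ l) 0 := ((hbranch.analytic_vec l).analyticAt hnhds).continuousAt
  -- `λ_l` is nonnegative near `0` and vanishes there, so the minimum kills its linear Taylor term.
  have hderiv : deriv (lam l) 0 = 0 := by
    refine IsLocalMin.deriv_eq_zero ?_
    filter_upwards [hnhds] with t ht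
    rw [hlam0]
    exact hpos t ht
  set γ := iteratedDeriv 2 (lam l) 0 / 2
  have hcube : Tendsto (fun t => (lam l t - γ * t ^ 2) / t ^ 3) (𝓝[≠] 0) (𝓝 (mu lam l)) :=
    tendsto_sub_div_cube (isBigO_sub_taylor_three hanal hlam0 hderiv)
  have hsq := tendsto_div_sq_of_tendsto_sub_div_cube hcube
  -- The bound `c t² ≤ λ_l(t)` passes to the limit as `c ≤ γ`; positivity is what allows division by
  -- `√γ` in the phase expansion.
  have hγ : 0 < γ := by
    refine hc.trans_le (ge_of_tendsto hsq ?_)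
    filter_upwards [nhdsWithin_le_nhds hnhds, self_mem_nhdsWithin] with t ht ht0
    have ht0' : t ≠ 0 := ht0
    rw [le_div_iff₀ (by positivity)]
    exact hle t ht
  have hfd : FiniteDimensional ℂ (pker X₀) := Module.finite_of_finrank_pos (by omega)
  have hgerm := germ_apply_of_tendsto hdense X₁ (pker X₀).closed_of_finiteDimensional hcont hω
    (by filter_upwards [hnhds] with t ht
        exact ⟨(hbranch.orthonormal t ht).1 l, hbranch.eigen l t ht⟩) hsq
  obtain ⟨θ, hθ, t, ht0, htt, hcos1, hcos2⟩ := exists_sequence_cos hγ hl hτ hcube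
  have hεt : Tendsto (fun k => θ * t k ^ 2) atTop (𝓝 0) := by
    simpa using (htt.pow 2).const_mul θ
  have hvec : Tendsto (fun k => ‖φ l (t k) - φ l 0‖) atTop (𝓝 0) :=
    tendsto_iff_norm_sub_tendsto_zero.1 (hcont.tendsto.comp htt)
  have hupper := (((tendsto_weight hs (θ := θ)).comp htt).const_mul (C * θ * θ ^ (-s))).add
    (hvec.const_mul 2)
  have hlower := (hcos2.sub_const 1).abs
  -- The left side tends to `|-1 - 1| = 2`, and both terms of the right side tend to `0`.
  have hlim := le_of_tendsto_of_tendsto hlower hupper (by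
    filter_upwards [htt.eventually_lt_const hη, hεt.eventually_lt_const hη,
      htt.eventually hnhds] with k hk1 hk2 hk3
    obtain ⟨hm, hev⟩ := hbranch.eigen l (t k) hk3
    have hk := hest (t k) (θ * t k ^ 2) (by rwa [abs_of_pos (ht0 k)])
      (mul_pos hθ (pow_pos (ht0 k) 2)) hk2
    have h1 := le_of_mul_weight_le hθ (ht0 k) hk
    have h2 := abs_cos_sub_cos_le hdense hclosed ((θ * t k ^ 2)⁻¹ * τ) (t k) (hpos _ hk3)
      ((hbranch.orthonormal _ hk3).1 l) ((hbranch.orthonormal _ h0).1 l) hω hm hev hgerm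
    rw [hcos1 k] at h2
    exact h2.trans (add_le_add_left h1 _))
  norm_num at hlim
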